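/- Let $n\ge 4$ and let $G=(N,A)$ be the complete directed graph with node set $N=\{1,\dots,n\}$ and arc set $A=\{ij : i,j\in N,\ i\ne j\}$. Put $N_1=N\setminus\{1\}$ and $A_1=\{ij : i,j\in N_1,\ i\neq j\}$, and let $\mathcal C_1$ be the set of (simple) directed cycles with arcs in $A_1$, each cycle $C$ being regarded as its set of arcs (cycles with two arcs $ij,ji$ are allowed), so that $|C|$ is its number of arcs. Let $$D=\Big\{d\in\mathbb R^{A_1} : d_{ij}>0\ \text{for all } ij\in A_1,\ \sum_{ij\in C}d_{ij}\le 1\ \text{for all } C\in\mathcal C_1\Big\}$$ and let $\overline D$ be its topological closure. Let $P_{\mathrm{AP}}$ be the set of $x\in[0,1]^A$ with $\sum_{j\ne i}x_{ij}=1$ and $\sum_{j\neq i}x_{ji}=1$ for all $i\in N$. For $d\in\overline D$ let $$P_{\mathrm{MTZ}}(d)=\Big\{x\in P_{\mathrm{AP}} : \exists\,u\in\mathbb R^{N_1}\ \text{with}\ u_i-u_j+d_{ij}\le 1-x_{ij}\ \text{for all } ij\in A_1\Big\}.$$ Then for each $d\in\overline D$ and each $C\in\mathcal C_1$, the inequality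 $$\sum_{ij\in C}x_{ij}\le |C|-\sum_{ij\in C}d_{ij}$$ defines a facet of $P_{\mathrm{MTZ}}(d)$ (that is, it is valid for $P_{\mathrm{MTZ}}(d)$ and the face of points of $P_{\mathrm{MTZ}}(d)$ satisfying it with equality is nonempty and has dimension $\dim P_{\mathrm{MTZ}}(d)-1$) if and only if $\sum_{ij\in C}d_{ij}>0$ and $|C|\le n-2$. -/

import Mathlib

namespace ATSP

/-- Arcs of the complete directed graph on the `n` nodes `Fin n`. An arc `a` is the ordered pair
`(a.1.1, a.1.2)` of distinct nodes. -/
abbrev Arc (n : ℕ) : Type := {p : Fin n × Fin n // p.1 ≠ p.2}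

/-- All nodes except the special one; the special node is the one with value `0`. -/
abbrev Node₁ (n : ℕ) : Type := {i : Fin n // i.val ≠ 0}

/-- The arcs both of whose ends are different from the special node. -/
abbrev Arc₁ (n : ℕ) : Type := {a : Arc n // a.1.1.val ≠ 0 ∧ a.1.2.val ≠ 0}

/-- The tail `i` of an arc `ij` avoiding the special node. -/
def Arc₁.src {n : ℕ} (a : Arc₁ n) : Node₁ n := ⟨a.1.1.1, a.2.1⟩

/-- The head `j` of an arc `ij` avoiding the special node. -/
def Arc₁.tgt {n : ℕ} (a : Arc₁ n) : Node₁ n := ⟨a.1.1.2, a.2.2⟩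

/-- `C`, a set of arcs avoiding the special node, is a (simple) directed cycle: it consists of the
arcs `v 0 → v 1 → ⋯ → v (k + 1) → v 0` for distinct nodes `v 0, …, v (k + 1)`, `k + 2 ≥ 2`.
Addition in `Fin (k + 2)` is cyclic. -/
def IsDirectedCycle {n : ℕ} (C : Finset (Arc₁ n)) : Prop :=
  ∃ (k : ℕ) (v : Fin (k + 2) → Node₁ n), Function.Injective v ∧
    ∀ a : Arc₁ n, a ∈ C ↔ ∃ i : Fin (k + 2), a.src = v i ∧ a.tgt = v (i + 1)

/-- The parameter set: positive vectors `d` whose sum along each directed cycle avoiding the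
special node is at most one. -/
def paramD (n : ℕ) : Set (Arc₁ n → ℝ) :=
  {d | (∀ a, 0 < d a) ∧ ∀ C : Finset (Arc₁ n), IsDirectedCycle C → ∑ a ∈ C, d a ≤ 1}

/-- The (restricted) assignment polytope. -/
def PAP (n : ℕ) : Set (Arc n → ℝ) :=
  {x | (∀ a, 0 ≤ x a ∧ x a ≤ 1) ∧
    (∀ i : Fin n, ∑ a : Arc n with a.1.1 = i, x a = 1) ∧
    (∀ i : Fin n, ∑ a : Arc n with a.1.2 = i, x a = 1)}

/-- The continuous relaxation of the extended `d`-MTZ formulation. -/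
def QMTZ {n : ℕ} (d : Arc₁ n → ℝ) : Set ((Arc n → ℝ) × (Node₁ n → ℝ)) :=
  {p | p.1 ∈ PAP n ∧ ∀ a : Arc₁ n, p.2 a.src - p.2 a.tgt + d a ≤ 1 - p.1 a.1}

/-- The projection of `QMTZ d` onto the `x` variables. -/
def PMTZ {n : ℕ} (d : Arc₁ n → ℝ) : Set (Arc n → ℝ) :=
  {x | ∃ u : Node₁ n → ℝ, (x, u) ∈ QMTZ d}

/-- The dimension of (the affine hull of) a nonempty set. -/
noncomputable def dimension {E : Type*} [AddCommGroup E] [Module ℝ E] (S : Set E) : ℕ :=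
  Module.finrank ℝ (vectorSpan ℝ S)

/-- The linear inequality `f x ≤ β` defines a facet of `P`: it is valid for `P`, and the face
`{x ∈ P | f x = β}` is nonempty and has dimension `dim P - 1`. -/
def DefinesFacet {E : Type*} [AddCommGroup E] [Module ℝ E]
    (P : Set E) (f : E →ₗ[ℝ] ℝ) (β : ℝ) : Prop :=
  (∀ x ∈ P, f x ≤ β) ∧ {x ∈ P | f x = β}.Nonempty ∧
    dimension {x ∈ P | f x = β} + 1 = dimension P

/-- The linear form `x ↦ ∑_{ij ∈ C} x_{ij}`. -/
def cycleSum {n : ℕ} (C : Finset (Arc₁ n)) : (Arc n → ℝ) →ₗ[ℝ] ℝ :=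
  ∑ a ∈ C, LinearMap.proj a.1

theorem cycleSum_apply {n : ℕ} (C : Finset (Arc₁ n)) (x : Arc n → ℝ) :
    cycleSum C x = ∑ a ∈ C, x a.1 := by
  simp [cycleSum]

end ATSP

/-!
Adding the arc inequalities around a cycle cancels the potential `u`, and conversely a potential
exists as soon as no cycle has negative weight. Hence `PMTZ d` is the assignment polytope cut by
the inequalities `cycleSum C x ≤ |C| - ∑ a ∈ C, d a`, one for each cycle `C`. All of them are
strict at the uniform point, so `PMTZ d` has the same affine hull as the assignment polytope.

If the sum of `d` along `C` is positive and `|C| ≤ n - 2`, take the incidence vector of a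
permutation consisting of `C` and one further cycle through all other nodes. Between it and the
uniform point lies a positive point at which the inequality of `C` is tight and all other cycle
inequalities are strict, and around that point the face is an open piece of a hyperplane.

Conversely, if the sum of `d` along `C` is at most `0`, every arc of `C` has value `1` on the face.
If `|C| = n - 1`, the arcs of `C` have total value at least `n - 2` on the face, which is the total
value of all arcs avoiding the special node; so those outside `C`, in particular the arcs of `C`
reversed, have value `0`. Either way the values of two consecutive arcs are constant on the face,
and this lowers the dimension by two.
-/

namespace ATSP

open Equiv Filter Finset Module Topology

section Potential

variable {V M : Type*}

/-- The total `w`-weight of the walk that starts at a vertex and then visits the entries of a list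
in their order. -/
def walkWeight [AddMonoid M] (w : V → V → M) : V → List V → M
  | _, [] => 0
  | i, j :: l => w i j + walkWeight w j l

theorem walkWeight_append_cons [AddMonoid M] (w : V → V → M) (i j : V) (l l' : List V) :
    walkWeight w i (l ++ j :: l') = walkWeight w i (l ++ [j]) + walkWeight w j l' := by
  induction l generalizing i with
  | nil => simp [walkWeight]
  | cons p l ih => simp only [List.cons_append, walkWeight, ih p, add_assoc]

theorem walkWeight_ofFn_append [AddCommMonoid M] (w : V → V → M) {k : ℕ}
    (v : Fin (k + 1) → V) (j : V) :
    walkWeight w (v 0) (List.ofFn (fun t : Fin k => v t.succ) ++ [j]) =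
      ∑ t : Fin k, w (v t.castSucc) (v t.succ) + w (v (Fin.last k)) j := by
  induction k with
  | zero => simp [walkWeight]
  | succ k ih =>
    rw [List.ofFn_succ, List.cons_append, walkWeight, Fin.sum_univ_succ, ih fun t => v t.succ,
      ← add_assoc]
    rfl

theorem sum_cyclic_eq_walkWeight [AddCommMonoid M] (w : V → V → M) {k : ℕ} (v : Fin (k + 2) → V) :
    ∑ t, w (v t) (v (t + 1)) =
      walkWeight w (v 0) (List.ofFn (fun t : Fin (k + 1) => v t.succ) ++ [v 0]) := by
  rw [walkWeight_ofFn_append, Fin.sum_univ_castSucc, Fin.last_add_one]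
  simp only [Fin.coeSucc_eq_succ]

/-- The potential of `i` is the least weight of a simple walk starting at `i`: prepending `i` to a
walk from `j` gives either a simple walk or a simple cycle followed by a simple walk from `i`. -/
theorem exists_potential [Finite V] [AddCommGroup M] [LinearOrder M] [IsOrderedAddMonoid M]
    {w : V → V → M}
    (hw : ∀ (k : ℕ) (v : Fin (k + 2) → V), Function.Injective v → 0 ≤ ∑ t, w (v t) (v (t + 1))) :
    ∃ u : V → M, ∀ i j, i ≠ j → u i - u j ≤ w i j := by
  have exists_min (i : V) : ∃ l, (i :: l).Nodup ∧
      ∀ l', (i :: l').Nodup → walkWeight w i l ≤ walkWeight w i l' := by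
    classical
    have := Fintype.ofFinite V
    have hfin : {l : List V | l.Nodup}.Finite :=
      Set.finite_coe_iff.1 (inferInstanceAs (Finite {l : List V // l.Nodup}))
    exact Set.exists_min_image _ (walkWeight w i)
      (hfin.subset fun _ hl => (List.nodup_cons.1 hl).2) ⟨[], List.nodup_singleton i⟩
  choose L hL hLmin using exists_min
  refine ⟨fun i => walkWeight w i (L i), fun i j hij => sub_le_iff_le_add.2 ?_⟩
  by_cases hi : i ∈ L j
  · obtain ⟨A, B, hAB⟩ := List.append_of_mem hi
    have hnodup : (j :: (A ++ i :: B)).Nodup := hAB ▸ hL j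
    have hcycle : 0 ≤ w i j + walkWeight w j (A ++ [i]) := by
      have hinj : (i :: j :: A).Nodup := by
        simp only [List.nodup_cons, List.nodup_append, List.mem_append, List.mem_cons] at hnodup ⊢
        grind
      have := hw A.length (i :: j :: A).get (List.nodup_iff_injective_get.1 hinj)
      rw [sum_cyclic_eq_walkWeight] at this
      simpa [walkWeight] using this
    have hrest : walkWeight w i (L i) ≤ walkWeight w i B :=
      hLmin i B (hnodup.sublist (by simp))
    calc walkWeight w i (L i) ≤ walkWeight w i B := hrest
      _ ≤ w i j + walkWeight w j (A ++ [i]) + walkWeight w i B := le_add_of_nonneg_left hcycle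
      _ = w i j + walkWeight w j (L j) := by rw [hAB, walkWeight_append_cons w j i A B, add_assoc]
  · exact hLmin i (j :: L j) (List.nodup_cons.2 ⟨by simp [hij, hi], hL j⟩)

end Potential

section Perm

variable {V : Type*} {s : Finset V} {σ τ : Perm V}

theorem isCycleOn_congr (hσ : σ.IsCycleOn s) (h : Set.EqOn σ τ s) : τ.IsCycleOn s := by
  have hpow (m : ℕ) {x : V} (hx : x ∈ s) : (τ ^ m) x = (σ ^ m) x ∧ (σ ^ m) x ∈ s := by
    induction m with
    | zero => simpa using hx
    | succ m ih =>
      rw [pow_succ', pow_succ', Perm.mul_apply, Perm.mul_apply, ih.1]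
      exact ⟨(h ih.2).symm, hσ.1.mapsTo ih.2⟩
  refine ⟨hσ.1.congr h, fun x hx y hy => ?_⟩
  obtain ⟨m, -, rfl⟩ := hσ.exists_pow_eq hx hy
  exact ⟨m, by rw [zpow_natCast, (hpow m hx).1]⟩

theorem eq_of_isCycleOn_of_mem {s t : Set V} (hs : σ.IsCycleOn s) (ht : σ.IsCycleOn t) {x : V}
    (hxs : x ∈ s) (hxt : x ∈ t) : s = t :=
  (hs.range_zpow hxs).symm.trans (ht.range_zpow hxt)

variable [Fintype V] [DecidableEq V]

theorem exists_isCycleOn_isCycleOn_compl (hτ : τ.IsCycleOn s) (hsupp : τ.support ⊆ s) :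
    ∃ σ : Perm V, Set.EqOn τ σ s ∧ σ.IsCycleOn s ∧ σ.IsCycleOn (sᶜ : Finset V) := by
  obtain ⟨ρ, hρ, hρsupp⟩ := sᶜ.exists_cycleOn
  have hτσ : Set.EqOn τ (τ * ρ) s := fun x hx => by
    rw [Perm.mul_apply, Perm.notMem_support.1 fun h => mem_compl.1 (hρsupp h) hx]
  have hρσ : Set.EqOn ρ (τ * ρ) (sᶜ : Finset V) := fun x hx =>
    (Perm.notMem_support.1 fun h => mem_compl.1 (hρ.1.mapsTo hx) (hsupp h)).symm
  exact ⟨τ * ρ, hτσ, isCycleOn_congr hτ hτσ, isCycleOn_congr hρ hρσ⟩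

theorem exists_isCycleOn_image {k : ℕ} {v : Fin (k + 2) → V} (hv : Function.Injective v) :
    ∃ τ : Perm V, (∀ t, τ (v t) = v (t + 1)) ∧ τ.IsCycleOn (univ.image v) ∧
      τ.support ⊆ univ.image v := by
  have hnodup : (List.ofFn v).Nodup := List.nodup_ofFn.2 hv
  refine ⟨(List.ofFn v).formPerm, fun t => ?_, ?_, fun x hx => ?_⟩
  · have := List.formPerm_apply_getElem _ hnodup t (by simp [-List.ofFn_succ])
    simpa [-List.ofFn_succ, Fin.add_def] using this
  · convert! hnodup.isCycleOn_formPerm using 1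
    ext x
    simp [-List.ofFn_succ, List.mem_ofFn]
  · simpa [-List.ofFn_succ, List.mem_ofFn] using List.support_formPerm_le _ hx

end Perm

section Cycle

variable {n : ℕ}

theorem Arc₁.ext_ends {a b : Arc₁ n} (htail : a.1.1.1 = b.1.1.1) (hhead : a.1.1.2 = b.1.1.2) :
    a = b :=
  Subtype.ext (Subtype.ext (Prod.ext htail hhead))

theorem Arc₁.src_ne_tgt (a : Arc₁ n) : a.src ≠ a.tgt :=
  fun h => a.1.2 (congrArg Subtype.val h)

/-- The arc joining two distinct nodes, both different from the special node. -/
def Arc₁.ofNe (p q : Node₁ n) (h : p ≠ q) : Arc₁ n :=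
  ⟨⟨(p.1, q.1), fun hpq => h (Subtype.ext hpq)⟩, p.2, q.2⟩

/-- The arc with the ends exchanged. -/
def Arc₁.reverse (a : Arc₁ n) : Arc₁ n :=
  Arc₁.ofNe _ _ a.src_ne_tgt.symm

/-- The directed cycle with arcs `v t → v (t + 1)`; addition in `Fin (k + 2)` is cyclic. -/
def cycleThrough {k : ℕ} (v : Fin (k + 2) ↪ Node₁ n) : Finset (Arc₁ n) :=
  univ.map ⟨fun t => Arc₁.ofNe (v t) (v (t + 1)) (v.injective.ne (left_ne_add.2 one_ne_zero)),
    fun _ _ h => v.injective (congrArg Arc₁.src h)⟩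

theorem isDirectedCycle_iff_exists_cycleThrough {C : Finset (Arc₁ n)} :
    IsDirectedCycle C ↔ ∃ (k : ℕ) (v : Fin (k + 2) ↪ Node₁ n), C = cycleThrough v := by
  have hmem {k : ℕ} (v : Fin (k + 2) ↪ Node₁ n) (a : Arc₁ n) :
      a ∈ cycleThrough v ↔ ∃ t, a.src = v t ∧ a.tgt = v (t + 1) := by
    simp only [cycleThrough, Finset.mem_map, mem_univ, true_and]
    refine exists_congr fun t => ⟨?_, fun h => ?_⟩
    · rintro rfl
      exact ⟨rfl, rfl⟩
    · exact Arc₁.ext_ends (congrArg Subtype.val h.1.symm) (congrArg Subtype.val h.2.symm)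
  constructor
  · rintro ⟨k, v, hv, hC⟩
    exact ⟨k, ⟨v, hv⟩, Finset.ext fun a => (hC a).trans (hmem ⟨v, hv⟩ a).symm⟩
  · rintro ⟨k, v, rfl⟩
    exact ⟨k, v, v.injective, hmem v⟩

theorem sum_cycleThrough {k : ℕ} (v : Fin (k + 2) ↪ Node₁ n) (w : Arc₁ n → ℝ) :
    ∑ a ∈ cycleThrough v, w a =
      ∑ t, w (Arc₁.ofNe (v t) (v (t + 1)) (v.injective.ne (left_ne_add.2 one_ne_zero))) :=
  sum_map _ _ _

theorem exists_potential_iff_forall_isDirectedCycle {w : Arc₁ n → ℝ} :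
    (∃ u : Node₁ n → ℝ, ∀ a, u a.src - u a.tgt ≤ w a) ↔
      ∀ C, IsDirectedCycle C → 0 ≤ ∑ a ∈ C, w a := by
  constructor
  · rintro ⟨u, hu⟩ C hC
    obtain ⟨k, v, rfl⟩ := isDirectedCycle_iff_exists_cycleThrough.1 hC
    calc 0 = ∑ t, (u (v t) - u (v (t + 1))) := by
          rw [sum_sub_distrib, eq_comm, sub_eq_zero]
          exact (Equiv.sum_comp (Equiv.addRight (1 : Fin (k + 2))) fun t => u (v t)).symm
      _ = ∑ a ∈ cycleThrough v, (u a.src - u a.tgt) :=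
          (sum_cycleThrough v fun a => u a.src - u a.tgt).symm
      _ ≤ ∑ a ∈ cycleThrough v, w a := sum_le_sum fun a _ => hu a
  · intro h
    let W (p q : Node₁ n) : ℝ := if hpq : p ≠ q then w (Arc₁.ofNe p q hpq) else 0
    obtain ⟨u, hu⟩ : ∃ u : Node₁ n → ℝ, ∀ i j, i ≠ j → u i - u j ≤ W i j := by
      refine exists_potential fun k v hv => ?_
      rw [sum_congr rfl fun _ _ => dif_pos (hv.ne (left_ne_add.2 one_ne_zero))]
      exact (h _ (isDirectedCycle_iff_exists_cycleThrough.2 ⟨k, ⟨v, hv⟩, rfl⟩)).trans_eq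
        (sum_cycleThrough ⟨v, hv⟩ w)
    exact ⟨u, fun a => (hu _ _ a.src_ne_tgt).trans_eq (dif_pos a.src_ne_tgt)⟩

theorem mem_PMTZ_iff {d : Arc₁ n → ℝ} {x : Arc n → ℝ} :
    x ∈ PMTZ d ↔ x ∈ PAP n ∧
      ∀ C, IsDirectedCycle C → cycleSum C x ≤ (C.card : ℝ) - ∑ a ∈ C, d a := by
  have hcycle (C : Finset (Arc₁ n)) : 0 ≤ ∑ a ∈ C, (1 - x a.1 - d a) ↔
      cycleSum C x ≤ (C.card : ℝ) - ∑ a ∈ C, d a := by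
    rw [sum_sub_distrib, sum_sub_distrib, sum_const, nsmul_one, ← cycleSum_apply, sub_right_comm,
      sub_nonneg]
  simp only [← hcycle, ← exists_potential_iff_forall_isDirectedCycle, PMTZ, QMTZ,
    Set.mem_ofPred_eq, exists_and_left, le_sub_iff_add_le]

/-- A permutation of all nodes that runs through the cycle `C`, whose node set is `S`, and through
a single cycle on the remaining nodes. The latter cycle contains the special node, so `C` is the
only subtour of `σ`. -/
structure IsSubtourCover (σ : Perm (Fin n)) (S : Finset (Fin n)) (C : Finset (Arc₁ n)) :
    Prop where
  nontrivial : S.Nontrivial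
  isCycleOn : σ.IsCycleOn S
  isCycleOn_compl : σ.IsCycleOn (Sᶜ : Finset (Fin n))
  val_ne_zero : ∀ i ∈ S, i.val ≠ 0
  mem_iff : ∀ a : Arc₁ n, a ∈ C ↔ a.1.1.1 ∈ S ∧ σ a.1.1.1 = a.1.1.2

theorem IsDirectedCycle.exists_isSubtourCover {C : Finset (Arc₁ n)} (hC : IsDirectedCycle C) :
    ∃ σ S, IsSubtourCover σ S C := by
  obtain ⟨k, v, hv, hmem⟩ := hC
  have hinj : Function.Injective fun t => (v t).1 := Subtype.val_injective.comp hv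
  obtain ⟨τ, hτv, hτ, hsupp⟩ := exists_isCycleOn_image hinj
  obtain ⟨σ, hτσ, hσ, hσcompl⟩ := exists_isCycleOn_isCycleOn_compl hτ hsupp
  have hσv (t : Fin (k + 2)) : σ (v t).1 = (v (t + 1)).1 := by
    rw [← hτv, hτσ (by simp)]
  refine ⟨σ, _, ?_, hσ, hσcompl, ?_, fun a => ?_⟩
  · rw [← one_lt_card_iff_nontrivial, card_image_of_injective _ hinj]
    simp
  · simp only [mem_image, mem_univ, true_and, forall_exists_index, forall_apply_eq_imp_iff]
    exact fun t => (v t).2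
  · simp only [hmem, mem_image, mem_univ, true_and, Subtype.ext_iff, ← hσv]
    constructor
    · rintro ⟨t, htail, hhead⟩
      exact ⟨⟨t, htail.symm⟩, by rw [← htail] at hhead; exact hhead.symm⟩
    · rintro ⟨⟨t, htail⟩, hhead⟩
      exact ⟨t, htail.symm, by rw [htail]; exact hhead.symm⟩

namespace IsSubtourCover

variable {σ : Perm (Fin n)} {S : Finset (Fin n)} {C : Finset (Arc₁ n)}

theorem apply_mem (h : IsSubtourCover σ S C) {i : Fin n} (hi : i ∈ S) : σ i ∈ S :=
  h.isCycleOn.1.mapsTo hi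

theorem exists_mem_of_mem (h : IsSubtourCover σ S C) {i : Fin n} (hi : i ∈ S) :
    ∃ a ∈ C, a.1.1 = (i, σ i) :=
  ⟨⟨⟨(i, σ i), (h.isCycleOn.apply_ne h.nontrivial hi).symm⟩, h.val_ne_zero _ hi,
    h.val_ne_zero _ (h.apply_mem hi)⟩, (h.mem_iff _).2 ⟨hi, rfl⟩, rfl⟩

theorem card_eq (h : IsSubtourCover σ S C) : C.card = S.card := by
  refine card_bij (fun a _ => a.1.1.1) (fun a ha => ((h.mem_iff a).1 ha).1) ?_ fun i hi => ?_
  · intro a ha b hb hab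
    refine Arc₁.ext_ends hab ?_
    rw [← ((h.mem_iff a).1 ha).2, ← ((h.mem_iff b).1 hb).2, hab]
  · obtain ⟨a, ha, hai⟩ := h.exists_mem_of_mem hi
    exact ⟨a, ha, congrArg Prod.fst hai⟩

theorem eq_of_forall_apply_eq (h : IsSubtourCover σ S C) {C' : Finset (Arc₁ n)}
    (hC' : IsDirectedCycle C') (hfollow : ∀ a ∈ C', σ a.1.1.1 = a.1.1.2) : C' = C := by
  obtain ⟨σ', S', h'⟩ := hC'.exists_isSubtourCover
  have heq : Set.EqOn σ' σ S' := fun i hi => by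
    obtain ⟨a, ha, hai⟩ := h'.exists_mem_of_mem hi
    simpa [hai] using (hfollow a ha).symm
  have hσ : σ.IsCycleOn S' := isCycleOn_congr h'.isCycleOn heq
  obtain ⟨i, hi⟩ := h'.nontrivial.nonempty
  obtain rfl : S' = S := by
    by_cases hiS : i ∈ S
    · exact coe_injective (eq_of_isCycleOn_of_mem hσ h.isCycleOn hi hiS)
    · have hcompl : S' = Sᶜ := coe_injective <|
        eq_of_isCycleOn_of_mem hσ h.isCycleOn_compl hi (mem_compl.2 hiS)
      have hspecial : (⟨0, i.pos⟩ : Fin n) ∈ S' := by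
        rw [hcompl, mem_compl]
        exact fun h0 => h.val_ne_zero _ h0 rfl
      exact absurd rfl (h'.val_ne_zero _ hspecial)
  ext a
  rw [h.mem_iff, h'.mem_iff]
  exact and_congr_right fun ha => by rw [heq ha]

theorem apply_ne (h : IsSubtourCover σ S C) (hcard : C.card ≤ n - 2) (i : Fin n) : σ i ≠ i := by
  by_cases hi : i ∈ S
  · exact h.isCycleOn.apply_ne h.nontrivial hi
  · have htwo : 1 < S.card := one_lt_card_iff_nontrivial.2 h.nontrivial
    have hcompl : (Sᶜ).Nontrivial := by
      rw [← one_lt_card_iff_nontrivial, card_compl, Fintype.card_fin, ← h.card_eq]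
      have := h.card_eq
      omega
    exact h.isCycleOn_compl.apply_ne hcompl (mem_compl.2 hi)

end IsSubtourCover

namespace IsDirectedCycle

variable {C : Finset (Arc₁ n)}

theorem two_le_card (hC : IsDirectedCycle C) : 2 ≤ C.card := by
  obtain ⟨σ, S, h⟩ := hC.exists_isSubtourCover
  exact h.card_eq ▸ one_lt_card_iff_nontrivial.2 h.nontrivial

theorem exists_consecutive (hC : IsDirectedCycle C) :
    ∃ a ∈ C, ∃ b ∈ C, a.1.1.2 = b.1.1.1 := by
  obtain ⟨σ, S, h⟩ := hC.exists_isSubtourCover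
  obtain ⟨i, hi⟩ := h.nontrivial.nonempty
  obtain ⟨a, ha, hai⟩ := h.exists_mem_of_mem hi
  obtain ⟨b, hb, hbi⟩ := h.exists_mem_of_mem (h.apply_mem hi)
  exact ⟨a, ha, b, hb, by rw [hai, hbi]⟩

theorem reverse_notMem (hC : IsDirectedCycle C) (hcard : 3 ≤ C.card) {a : Arc₁ n} (ha : a ∈ C) :
    a.reverse ∉ C := by
  obtain ⟨σ, S, h⟩ := hC.exists_isSubtourCover
  intro hrev
  obtain ⟨haS, hσa⟩ := (h.mem_iff a).1 ha
  have hσσa : σ (σ a.1.1.1) = a.1.1.1 := hσa ▸ ((h.mem_iff _).1 hrev).2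
  have hdvd : S.card ∣ 2 := (h.isCycleOn.pow_apply_eq haS).1 hσσa
  have := Nat.le_of_dvd two_pos hdvd
  have := h.card_eq
  omega

end IsDirectedCycle

end Cycle

section Dimension

variable {K E : Type*} [Field K] [AddCommGroup E] [Module K E] {U : Submodule K E} {S : Set E}

theorem finrank_inf_ker_add_one [FiniteDimensional K E] {g : E →ₗ[K] K} {y : E} (hy : y ∈ U)
    (hgy : g y ≠ 0) : finrank K ↥(U ⊓ LinearMap.ker g) + 1 = finrank K U := by
  have hg : g.domRestrict U ≠ 0 := fun h => hgy (LinearMap.congr_fun h ⟨y, hy⟩)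
  rw [← Module.Dual.finrank_ker_add_one_of_ne_zero hg, LinearMap.ker_domRestrict,
    ← Submodule.finrank_map_subtype_eq, Submodule.map_comap_subtype]

theorem vectorSpan_le_iff : vectorSpan K S ≤ U ↔ ∀ x ∈ S, ∀ y ∈ S, x - y ∈ U := by
  simp only [vectorSpan_def, Submodule.span_le, Set.vsub_subset_iff, vsub_eq_sub, SetLike.mem_coe]

theorem vectorSpan_le_ker {g : E →ₗ[K] K} {c : K} (h : ∀ x ∈ S, g x = c) :
    vectorSpan K S ≤ LinearMap.ker g :=
  vectorSpan_le_iff.2 fun x hx y hy => by rw [LinearMap.mem_ker, map_sub, h x hx, h y hy, sub_self]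

theorem vectorSpan_eq_of_forall_exists_add_smul_mem {x : E} (hS : vectorSpan K S ≤ U)
    (hx : x ∈ S) (h : ∀ y ∈ U, ∃ t : K, t ≠ 0 ∧ x + t • y ∈ S) : vectorSpan K S = U := by
  refine le_antisymm hS fun y hy => ?_
  obtain ⟨t, ht, hty⟩ := h y hy
  have hmem := vsub_mem_vectorSpan K hty hx
  rw [vsub_eq_sub, add_sub_cancel_left] at hmem
  exact (Submodule.smul_mem_iff _ ht).1 hmem

end Dimension

section Assignment

variable {n : ℕ} {S : Set (Arc n → ℝ)}

/-- The vectors whose sums over the arcs leaving a node and over the arcs entering a node all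
vanish: the directions of the affine subspace cut out by the equations of `PAP n`. -/
def assignmentDirection (n : ℕ) : Submodule ℝ (Arc n → ℝ) where
  carrier := {y | (∀ i : Fin n, ∑ a : Arc n with a.1.1 = i, y a = 0) ∧
    ∀ i : Fin n, ∑ a : Arc n with a.1.2 = i, y a = 0}
  zero_mem' := by simp
  add_mem' := by
    rintro x y ⟨hx, hx'⟩ ⟨hy, hy'⟩
    simp [sum_add_distrib, hx, hx', hy, hy']
  smul_mem' := by
    rintro c x ⟨hx, hx'⟩
    simp [← mul_sum, hx, hx']

theorem mem_PAP_of_nonneg {x : Arc n → ℝ} (hnonneg : ∀ a, 0 ≤ x a)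
    (htail : ∀ i : Fin n, ∑ a : Arc n with a.1.1 = i, x a = 1)
    (hhead : ∀ i : Fin n, ∑ a : Arc n with a.1.2 = i, x a = 1) : x ∈ PAP n := by
  refine ⟨fun a => ⟨hnonneg a, ?_⟩, htail, hhead⟩
  rw [← htail a.1.1]
  exact single_le_sum (f := x) (fun b _ => hnonneg b) (by simp)

theorem convex_PAP : Convex ℝ (PAP n) := by
  rintro x ⟨hx, hxtail, hxhead⟩ y ⟨hy, hytail, hyhead⟩ s t hs ht hst
  refine mem_PAP_of_nonneg (fun a => ?_) (fun i => ?_) fun i => ?_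
  · exact add_nonneg (mul_nonneg hs (hx a).1) (mul_nonneg ht (hy a).1)
  · simp [sum_add_distrib, ← mul_sum, hxtail, hytail, hst]
  · simp [sum_add_distrib, ← mul_sum, hxhead, hyhead, hst]

theorem sub_mem_assignmentDirection {x y : Arc n → ℝ} (hx : x ∈ PAP n) (hy : y ∈ PAP n) :
    x - y ∈ assignmentDirection n :=
  ⟨fun i => by simp [sum_sub_distrib, hx.2.1, hy.2.1],
    fun i => by simp [sum_sub_distrib, hx.2.2, hy.2.2]⟩

theorem vectorSpan_le_assignmentDirection (hS : S ⊆ PAP n) :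
    vectorSpan ℝ S ≤ assignmentDirection n :=
  vectorSpan_le_iff.2 fun _ hx _ hy => sub_mem_assignmentDirection (hS hx) (hS hy)

theorem sum_tail_eq {M : Type*} [AddCommMonoid M] (i : Fin n)
    (f : Fin n → Fin n → M) :
    ∑ a : Arc n with a.1.1 = i, f a.1.1 a.1.2 = ∑ j ∈ univ.erase i, f i j := by
  refine sum_bij' (fun a _ => a.1.2)
    (fun j hj => ⟨(i, j), (ne_of_mem_erase hj).symm⟩) ?_ ?_ ?_ ?_ ?_ <;> grind

theorem sum_head_eq {M : Type*} [AddCommMonoid M] (i : Fin n)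
    (f : Fin n → Fin n → M) :
    ∑ a : Arc n with a.1.2 = i, f a.1.1 a.1.2 = ∑ j ∈ univ.erase i, f j i := by
  refine sum_bij' (fun a _ => a.1.1)
    (fun j hj => ⟨(j, i), ne_of_mem_erase hj⟩) ?_ ?_ ?_ ?_ ?_ <;> grind

theorem mul_mem_assignmentDirection {r c : Fin n → ℝ} (hr : ∑ i, r i = 0) (hc : ∑ i, c i = 0)
    (hrc : ∀ i, r i * c i = 0) :
    (fun a : Arc n => r a.1.1 * c a.1.2) ∈ assignmentDirection n := by
  refine ⟨fun i => ?_, fun i => ?_⟩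
  · rw [sum_tail_eq i fun i j => r i * c j, sum_erase (f := fun j => r i * c j) _ (hrc i),
      ← mul_sum, hc, mul_zero]
  · rw [sum_head_eq i fun i j => r i * c j, sum_erase (f := fun j => r j * c i) _ (hrc i),
      ← sum_mul, hr, zero_mul]

/-- The vector alternates along the rectangle with rows `p, k` and columns `q, l`, where `a = pq`
and `k, l` are two further nodes. -/
theorem exists_mem_assignmentDirection_apply_ne_zero (hn : 4 ≤ n) (a : Arc n) :
    ∃ y ∈ assignmentDirection n, y a ≠ 0 ∧ ∀ b : Arc n, b.1.2 = a.1.1 → y b = 0 := by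
  obtain ⟨⟨p, q⟩, hpq⟩ := a
  obtain ⟨k, l, hk, hl, hkl⟩ : ∃ k l, k ∉ ({p, q} : Finset (Fin n)) ∧
      l ∉ ({p, q} : Finset (Fin n)) ∧ k ≠ l := by
    have hcard : 1 < (({p, q} : Finset (Fin n))ᶜ).card := by
      rw [card_compl, Fintype.card_fin, card_pair hpq]
      omega
    simpa [and_assoc] using one_lt_card.1 hcard
  simp only [mem_insert, mem_singleton, not_or] at hk hl
  refine ⟨_, mul_mem_assignmentDirection (r := Pi.single p 1 - Pi.single k 1)
    (c := Pi.single q 1 - Pi.single l 1) ?_ ?_ fun i => ?_, ?_, ?_⟩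
  · simp
  · simp
  · simp only [Pi.sub_apply, Pi.single_apply]
    grind
  · simp [hk, hl]
  · rintro ⟨⟨i, j⟩, hij⟩ rfl
    simp only [Pi.sub_apply, Pi.single_apply]
    grind

theorem dimension_add_two_le (hn : 4 ≤ n) (hS : S ⊆ PAP n) {a b : Arc n} (hab : a.1.2 = b.1.1)
    {s t : ℝ} (ha : ∀ x ∈ S, x a = s) (hb : ∀ x ∈ S, x b = t) :
    dimension S + 2 ≤ finrank ℝ (assignmentDirection n) := by
  obtain ⟨y, hy, hya, -⟩ := exists_mem_assignmentDirection_apply_ne_zero hn a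
  obtain ⟨z, hz, hzb, hza⟩ := exists_mem_assignmentDirection_apply_ne_zero hn b
  let U := assignmentDirection n ⊓ LinearMap.ker (LinearMap.proj (R := ℝ) a)
  have hU : finrank ℝ U + 1 = finrank ℝ (assignmentDirection n) := finrank_inf_ker_add_one hy hya
  have hUb : finrank ℝ ↥(U ⊓ LinearMap.ker (LinearMap.proj b)) + 1 = finrank ℝ U :=
    finrank_inf_ker_add_one (y := z) ⟨hz, hza a hab⟩ hzb
  have hle : dimension S ≤ finrank ℝ ↥(U ⊓ LinearMap.ker (LinearMap.proj b)) :=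
    Submodule.finrank_mono <| le_inf
      (le_inf (vectorSpan_le_assignmentDirection hS) (vectorSpan_le_ker ha)) (vectorSpan_le_ker hb)
  omega

theorem sum_arc₁ {x : Arc n → ℝ} (hn : 0 < n) (hx : x ∈ PAP n) :
    ∑ a : Arc₁ n, x a.1 = (n : ℝ) - 2 := by
  let o : Fin n := ⟨0, hn⟩
  have val_ne_zero_iff (i : Fin n) : i.val ≠ 0 ↔ i ≠ o := by simp [o, Fin.ext_iff]
  have htotal : ∑ a, x a = n := by
    rw [← sum_fiberwise univ (fun a : Arc n => a.1.1) x]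
    simp [hx.2.1]
  calc ∑ a : Arc₁ n, x a.1
      = ∑ a : Arc n with a.1.1.val ≠ 0 ∧ a.1.2.val ≠ 0, x a := (sum_subtype _ (by simp) x).symm
    _ = ∑ a, x a - ∑ a : Arc n with a.1.1 = o, x a - ∑ a : Arc n with a.1.2 = o, x a := by
        simp only [sum_filter, ← sum_sub_distrib, val_ne_zero_iff]
        refine sum_congr rfl fun a _ => ?_
        have := a.2
        grind
    _ = n - 2 := by rw [htotal, hx.2.1, hx.2.2]; ring

end Assignment

section Point

variable {n : ℕ} {C : Finset (Arc₁ n)}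

/-- The point of `PAP n` all of whose coordinates are equal. -/
noncomputable def uniformVector (n : ℕ) : Arc n → ℝ :=
  fun _ => 1 / ((n : ℝ) - 1)

theorem uniformVector_mem_PAP (hn : 2 ≤ n) : uniformVector n ∈ PAP n := by
  have hpos : (0 : ℝ) < n - 1 := sub_pos.2 (by exact_mod_cast hn)
  have hsum (i : Fin n) : ∑ _j ∈ univ.erase i, 1 / ((n : ℝ) - 1) = 1 := by
    rw [sum_const, card_erase_of_mem (mem_univ i), card_univ, Fintype.card_fin, nsmul_eq_mul,
      Nat.cast_sub (by omega), Nat.cast_one, mul_one_div_cancel hpos.ne']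
  exact mem_PAP_of_nonneg (fun _ => (one_div_pos.2 hpos).le)
    (fun i => (sum_tail_eq i fun _ _ => _).trans (hsum i))
    (fun i => (sum_head_eq i fun _ _ => _).trans (hsum i))

theorem uniformVector_pos (hn : 2 ≤ n) (a : Arc n) : 0 < uniformVector n a :=
  one_div_pos.2 (sub_pos.2 (by exact_mod_cast hn))

theorem cycleSum_uniformVector_lt (hn : 4 ≤ n) (hC : IsDirectedCycle C) :
    cycleSum C (uniformVector n) < (C.card : ℝ) - 1 := by
  have hn' : (4 : ℝ) ≤ n := by exact_mod_cast hn
  have hcard : (2 : ℝ) ≤ C.card := by exact_mod_cast hC.two_le_card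
  calc cycleSum C (uniformVector n) = C.card / ((n : ℝ) - 1) := by
        simp [cycleSum_apply, uniformVector, div_eq_mul_inv]
    _ ≤ C.card / 3 := by gcongr; linarith
    _ < C.card - 1 := by linarith

/-- The incidence vector of the arcs along which a permutation moves the nodes. -/
def permVector (σ : Perm (Fin n)) : Arc n → ℝ :=
  fun a => if σ a.1.1 = a.1.2 then 1 else 0

theorem permVector_mem_PAP {σ : Perm (Fin n)} (hσ : ∀ i, σ i ≠ i) : permVector σ ∈ PAP n := by
  refine mem_PAP_of_nonneg (fun a => ?_) (fun i => ?_) fun i => ?_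
  · rw [permVector]
    split_ifs <;> norm_num
  · exact (sum_tail_eq i fun i j => if σ i = j then 1 else 0).trans (by simp [hσ])
  · have hi : σ.symm i ≠ i := fun h => hσ i (by rw [← h, σ.apply_symm_apply, h])
    refine (sum_head_eq i fun i j => if σ i = j then 1 else 0).trans ?_
    simp [← Equiv.eq_symm_apply, hi]

theorem cycleSum_permVector_le {σ : Perm (Fin n)} {a : Arc₁ n} (ha : a ∈ C)
    (hσ : σ a.1.1.1 ≠ a.1.1.2) : cycleSum C (permVector σ) ≤ (C.card : ℝ) - 1 := by
  calc cycleSum C (permVector σ) = ∑ b ∈ C.erase a, permVector σ b.1 := by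
        rw [cycleSum_apply, ← add_sum_erase C _ ha, permVector, if_neg hσ, zero_add]
    _ ≤ ∑ _b ∈ C.erase a, 1 := sum_le_sum fun b _ => by
        rw [permVector]
        split_ifs <;> norm_num
    _ = C.card - 1 := by
        rw [← cast_card, card_erase_of_mem ha, Nat.cast_sub (card_pos.2 ⟨a, ha⟩), Nat.cast_one]

theorem IsSubtourCover.cycleSum_permVector {σ : Perm (Fin n)} {S : Finset (Fin n)}
    (h : IsSubtourCover σ S C) : cycleSum C (permVector σ) = C.card := by
  rw [cycleSum_apply, cast_card]
  exact sum_congr rfl fun a ha => if_pos ((h.mem_iff a).1 ha).2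

theorem IsSubtourCover.cycleSum_permVector_le_of_ne {σ : Perm (Fin n)} {S : Finset (Fin n)}
    (h : IsSubtourCover σ S C) {C' : Finset (Arc₁ n)} (hC' : IsDirectedCycle C') (hne : C' ≠ C) :
    cycleSum C' (permVector σ) ≤ (C'.card : ℝ) - 1 := by
  obtain ⟨a, ha, hσa⟩ : ∃ a ∈ C', σ a.1.1.1 ≠ a.1.1.2 := by
    by_contra! hfollow
    exact hne (h.eq_of_forall_apply_eq hC' hfollow)
  exact cycleSum_permVector_le ha hσa

end Point

section Facet

variable {n : ℕ} {d : Arc₁ n → ℝ} {C : Finset (Arc₁ n)}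

theorem eventually_add_mul_le {p q β : ℝ} (hp : p ≤ β) (h : q = 0 ∨ p < β) :
    ∀ᶠ t in 𝓝 (0 : ℝ), p + t * q ≤ β := by
  rcases h with rfl | hlt
  · simpa using hp
  · have hcont : Continuous fun t : ℝ => p + t * q := by fun_prop
    exact (hcont.continuousAt.eventually_lt_const (by simpa using hlt)).mono fun _ => le_of_lt

theorem exists_add_smul_mem_PMTZ {x y : Arc n → ℝ} (hx : x ∈ PMTZ d) (hpos : ∀ a, 0 < x a)
    (hy : y ∈ assignmentDirection n)
    (h : ∀ C, IsDirectedCycle C →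
      cycleSum C y = 0 ∨ cycleSum C x < (C.card : ℝ) - ∑ a ∈ C, d a) :
    ∃ t : ℝ, t ≠ 0 ∧ x + t • y ∈ PMTZ d := by
  obtain ⟨hxPAP, hxcycle⟩ := mem_PMTZ_iff.1 hx
  have hnonneg : ∀ᶠ t in 𝓝 (0 : ℝ), ∀ a, 0 ≤ x a + t * y a := by
    refine eventually_all.2 fun a => ?_
    filter_upwards [eventually_add_mul_le (q := -y a) (neg_nonpos.2 (hpos a).le)
      (Or.inr (neg_neg_of_pos (hpos a)))] with t ht
    linarith
  have hcycle : ∀ᶠ t in 𝓝 (0 : ℝ), ∀ C, IsDirectedCycle C →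
      cycleSum C x + t * cycleSum C y ≤ (C.card : ℝ) - ∑ a ∈ C, d a :=
    eventually_all.2 fun C => eventually_imp_distrib_left.2 fun hC =>
      eventually_add_mul_le (hxcycle C hC) (h C hC)
  obtain ⟨t, ⟨ht, htC⟩, ht0⟩ :=
    (((hnonneg.and hcycle).filter_mono nhdsWithin_le_nhds).and
      (self_mem_nhdsWithin (s := {0}ᶜ))).exists
  refine ⟨t, ht0, mem_PMTZ_iff.2 ⟨mem_PAP_of_nonneg ht (fun i => ?_) fun i => ?_, fun C hC => ?_⟩⟩
  · simp [sum_add_distrib, ← mul_sum, hxPAP.2.1, hy.1]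
  · simp [sum_add_distrib, ← mul_sum, hxPAP.2.2, hy.2]
  · simpa using htC C hC

theorem vectorSpan_PMTZ_le {S : Set (Arc n → ℝ)} (hS : S ⊆ PMTZ d) :
    vectorSpan ℝ S ≤ assignmentDirection n :=
  vectorSpan_le_assignmentDirection fun _ hx => (mem_PMTZ_iff.1 (hS hx)).1

theorem dimension_PMTZ (hn : 4 ≤ n) (hd : ∀ C, IsDirectedCycle C → ∑ a ∈ C, d a ≤ 1) :
    dimension (PMTZ d) = finrank ℝ (assignmentDirection n) := by
  have hlt {C : Finset (Arc₁ n)} (hC : IsDirectedCycle C) :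
      cycleSum C (uniformVector n) < (C.card : ℝ) - ∑ a ∈ C, d a :=
    (cycleSum_uniformVector_lt hn hC).trans_le (sub_le_sub_left (hd C hC) _)
  have hmem : uniformVector n ∈ PMTZ d :=
    mem_PMTZ_iff.2 ⟨uniformVector_mem_PAP (by omega), fun C hC => (hlt hC).le⟩
  rw [dimension, vectorSpan_eq_of_forall_exists_add_smul_mem (vectorSpan_PMTZ_le subset_rfl) hmem
    fun y hy => exists_add_smul_mem_PMTZ hmem (uniformVector_pos (by omega)) hy
      fun C hC => Or.inr (hlt hC)]

/-- The point lies on the segment from the incidence vector of a permutation with the only subtour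
`C`, at which the cycle sum of `C` is `|C|`, to the uniform point, at which it is less than
`|C| - 1`. -/
theorem exists_pos_mem_PMTZ_cycleSum_eq (hn : 4 ≤ n)
    (hd : ∀ C, IsDirectedCycle C → ∑ a ∈ C, d a ≤ 1) (hC : IsDirectedCycle C)
    (hpos : 0 < ∑ a ∈ C, d a) (hcard : C.card ≤ n - 2) :
    ∃ x ∈ PMTZ d, (∀ a, 0 < x a) ∧ cycleSum C x = (C.card : ℝ) - ∑ a ∈ C, d a ∧
      ∀ C', IsDirectedCycle C' → C' ≠ C → cycleSum C' x < (C'.card : ℝ) - ∑ a ∈ C', d a := by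
  obtain ⟨σ, S, h⟩ := hC.exists_isSubtourCover
  let z := permVector σ
  let w := uniformVector n
  have hzPAP : z ∈ PAP n := permVector_mem_PAP (h.apply_ne hcard)
  have hwlt {C' : Finset (Arc₁ n)} (hC' : IsDirectedCycle C') : cycleSum C' w < C'.card - 1 :=
    cycleSum_uniformVector_lt hn hC'
  have hgap : 1 < C.card - cycleSum C w := by linarith [hwlt hC]
  obtain ⟨t, ht, ht1, htgap⟩ : ∃ t : ℝ, 0 < t ∧ t < 1 ∧
      t * (C.card - cycleSum C w) = ∑ a ∈ C, d a :=
    ⟨_, div_pos hpos (by linarith), (div_lt_one (by linarith)).2 ((hd C hC).trans_lt hgap),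
      div_mul_cancel₀ _ (by linarith)⟩
  let x := (1 - t) • z + t • w
  have hcycleSum (C' : Finset (Arc₁ n)) :
      cycleSum C' x = (1 - t) * cycleSum C' z + t * cycleSum C' w := by simp [x]
  have hxC : cycleSum C x = (C.card : ℝ) - ∑ a ∈ C, d a := by
    rw [hcycleSum, h.cycleSum_permVector, ← htgap]
    ring
  have hlt (C' : Finset (Arc₁ n)) (hC' : IsDirectedCycle C') (hne : C' ≠ C) :
      cycleSum C' x < (C'.card : ℝ) - ∑ a ∈ C', d a := by
    calc cycleSum C' x = (1 - t) * cycleSum C' z + t * cycleSum C' w := hcycleSum C'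
      _ < (1 - t) * (C'.card - 1) + t * (C'.card - 1) :=
        add_lt_add_of_le_of_lt
          (mul_le_mul_of_nonneg_left (h.cycleSum_permVector_le_of_ne hC' hne) (sub_nonneg.2 ht1.le))
          (mul_lt_mul_of_pos_left (hwlt hC') ht)
      _ = C'.card - 1 := by ring
      _ ≤ C'.card - ∑ a ∈ C', d a := sub_le_sub_left (hd C' hC') _
  refine ⟨x, mem_PMTZ_iff.2 ⟨?_, fun C' hC' => ?_⟩, fun a => ?_, hxC, hlt⟩
  · exact convex_PAP hzPAP (uniformVector_mem_PAP (by omega)) (by linarith) ht.le (by ring)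
  · rcases eq_or_ne C' C with rfl | hne
    exacts [hxC.le, (hlt C' hC' hne).le]
  · exact add_pos_of_nonneg_of_pos (mul_nonneg (sub_nonneg.2 ht1.le) (hzPAP.1 a).1)
      (mul_pos ht (uniformVector_pos (by omega) a))

theorem definesFacet_of_pos (hn : 4 ≤ n) (hd : ∀ C, IsDirectedCycle C → ∑ a ∈ C, d a ≤ 1)
    (hC : IsDirectedCycle C) (hpos : 0 < ∑ a ∈ C, d a) (hcard : C.card ≤ n - 2) :
    DefinesFacet (PMTZ d) (cycleSum C) ((C.card : ℝ) - ∑ a ∈ C, d a) := by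
  obtain ⟨x, hx, hx0, hxC, hlt⟩ := exists_pos_mem_PMTZ_cycleSum_eq hn hd hC hpos hcard
  have hspan : vectorSpan ℝ {y ∈ PMTZ d | cycleSum C y = (C.card : ℝ) - ∑ a ∈ C, d a} =
      assignmentDirection n ⊓ LinearMap.ker (cycleSum C) := by
    refine vectorSpan_eq_of_forall_exists_add_smul_mem
      (le_inf (vectorSpan_PMTZ_le fun y hy => hy.1) (vectorSpan_le_ker fun y hy => hy.2))
      ⟨hx, hxC⟩ fun y ⟨hy, (hyC : cycleSum C y = 0)⟩ => ?_
    obtain ⟨t, ht, hmem⟩ := exists_add_smul_mem_PMTZ hx hx0 hy fun C' hC' => by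
      rcases eq_or_ne C' C with rfl | hne
      exacts [Or.inl hyC, Or.inr (hlt C' hC' hne)]
    exact ⟨t, ht, hmem, by simp [hxC, hyC]⟩
  refine ⟨fun y hy => (mem_PMTZ_iff.1 hy).2 C hC, ⟨x, hx, hxC⟩, ?_⟩
  rw [dimension_PMTZ hn hd, dimension, hspan]
  refine finrank_inf_ker_add_one (sub_mem_assignmentDirection (mem_PMTZ_iff.1 hx).1
    (uniformVector_mem_PAP (by omega))) ?_
  have := cycleSum_uniformVector_lt hn hC
  have := hd C hC
  rw [map_sub, hxC]
  exact ne_of_gt (by linarith)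

theorem not_definesFacet_of_consecutive (hn : 4 ≤ n)
    (hd : ∀ C, IsDirectedCycle C → ∑ a ∈ C, d a ≤ 1) {f : (Arc n → ℝ) →ₗ[ℝ] ℝ} {β : ℝ}
    {a b : Arc n} (hab : a.1.2 = b.1.1) {s t : ℝ} (ha : ∀ x ∈ PMTZ d, f x = β → x a = s)
    (hb : ∀ x ∈ PMTZ d, f x = β → x b = t) : ¬DefinesFacet (PMTZ d) f β := by
  rintro ⟨-, -, hdim⟩
  have hface : {x ∈ PMTZ d | f x = β} ⊆ PAP n := fun x hx => (mem_PMTZ_iff.1 hx.1).1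
  have := dimension_add_two_le hn hface hab (fun x hx => ha x hx.1 hx.2) fun x hx => hb x hx.1 hx.2
  rw [dimension_PMTZ hn hd] at hdim
  omega

theorem eq_one_of_cycleSum_eq {x : Arc n → ℝ} (hx : x ∈ PAP n) (hd : ∑ a ∈ C, d a ≤ 0)
    (hxC : cycleSum C x = (C.card : ℝ) - ∑ a ∈ C, d a) {a : Arc₁ n} (ha : a ∈ C) :
    x a.1 = 1 := by
  have hnonneg (b : Arc₁ n) : 0 ≤ 1 - x b.1 := sub_nonneg.2 (hx.1 b.1).2
  have hsum : ∑ b ∈ C, (1 - x b.1) = ∑ b ∈ C, d b := by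
    rw [sum_sub_distrib, ← cycleSum_apply, hxC, ← cast_card]
    ring
  linarith [hnonneg a, single_le_sum (fun b _ => hnonneg b) ha]

theorem eq_zero_of_cycleSum_eq {x : Arc n → ℝ} (hx : x ∈ PAP n) (hd : ∑ a ∈ C, d a ≤ 1)
    (hcard : n ≤ C.card + 1) (hxC : cycleSum C x = (C.card : ℝ) - ∑ a ∈ C, d a) {a : Arc₁ n}
    (ha : a ∉ C) : x a.1 = 0 := by
  have hcard' : (n : ℝ) ≤ C.card + 1 := by exact_mod_cast hcard
  have hsum : x a.1 + cycleSum C x ≤ n - 2 := by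
    rw [cycleSum_apply, ← sum_insert (f := fun b : Arc₁ n => x b.1) ha,
      ← sum_arc₁ a.1.1.1.pos hx]
    exact sum_le_univ_sum_of_nonneg fun b => (hx.1 b.1).1
  linarith [(hx.1 a.1).1]

theorem pos_of_definesFacet (hn : 4 ≤ n) (hd : ∀ C, IsDirectedCycle C → ∑ a ∈ C, d a ≤ 1)
    (hC : IsDirectedCycle C)
    (h : DefinesFacet (PMTZ d) (cycleSum C) ((C.card : ℝ) - ∑ a ∈ C, d a)) :
    0 < ∑ a ∈ C, d a := by
  contrapose! h
  obtain ⟨a, ha, b, hb, hab⟩ := hC.exists_consecutive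
  exact not_definesFacet_of_consecutive hn hd hab
    (fun x hx hxC => eq_one_of_cycleSum_eq (mem_PMTZ_iff.1 hx).1 h hxC ha)
    (fun x hx hxC => eq_one_of_cycleSum_eq (mem_PMTZ_iff.1 hx).1 h hxC hb)

theorem card_le_of_definesFacet (hn : 4 ≤ n) (hd : ∀ C, IsDirectedCycle C → ∑ a ∈ C, d a ≤ 1)
    (hC : IsDirectedCycle C)
    (h : DefinesFacet (PMTZ d) (cycleSum C) ((C.card : ℝ) - ∑ a ∈ C, d a)) :
    C.card ≤ n - 2 := by
  contrapose! h
  obtain ⟨a, ha, b, hb, hab⟩ := hC.exists_consecutive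
  have hzero {c : Arc₁ n} (hc : c ∈ C) (x : Arc n → ℝ) (hx : x ∈ PMTZ d)
      (hxC : cycleSum C x = (C.card : ℝ) - ∑ a ∈ C, d a) : x c.reverse.1 = 0 :=
    eq_zero_of_cycleSum_eq (mem_PMTZ_iff.1 hx).1 (hd C hC) (by omega) hxC
      (hC.reverse_notMem (by omega) hc)
  exact not_definesFacet_of_consecutive hn hd (a := b.reverse.1) (b := a.reverse.1) hab.symm
    (hzero hb) (hzero ha)

theorem sum_le_one_of_mem_closure_paramD (hd : d ∈ closure (paramD n)) (hC : IsDirectedCycle C) :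
    ∑ a ∈ C, d a ≤ 1 :=
  closure_minimal (t := {d : Arc₁ n → ℝ | ∑ a ∈ C, d a ≤ 1}) (fun _ h => h.2 C hC)
    (isClosed_le (by fun_prop) continuous_const) hd

end Facet

end ATSP

theorem mainTheorem8_general (n : ℕ) (hn : 4 ≤ n) (d : ATSP.Arc₁ n → ℝ)
    (hd : ∀ C, ATSP.IsDirectedCycle C → ∑ a ∈ C, d a ≤ 1)
    (C : Finset (ATSP.Arc₁ n)) (hC : ATSP.IsDirectedCycle C) :
    ATSP.DefinesFacet (ATSP.PMTZ d) (ATSP.cycleSum C) ((C.card : ℝ) - ∑ a ∈ C, d a) ↔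
      0 < ∑ a ∈ C, d a ∧ C.card ≤ n - 2 :=
  ⟨fun h => ⟨ATSP.pos_of_definesFacet hn hd hC h, ATSP.card_le_of_definesFacet hn hd hC h⟩,
    fun h => ATSP.definesFacet_of_pos hn hd hC h.1 h.2⟩

theorem mainTheorem8 (n : ℕ) (hn : 4 ≤ n) (d : ATSP.Arc₁ n → ℝ) (hd : d ∈ closure (ATSP.paramD n))
    (C : Finset (ATSP.Arc₁ n)) (hC : ATSP.IsDirectedCycle C) :
    ATSP.DefinesFacet (ATSP.PMTZ d) (ATSP.cycleSum C) ((C.card : ℝ) - ∑ a ∈ C, d a) ↔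
      0 < ∑ a ∈ C, d a ∧ C.card ≤ n - 2 :=
  mainTheorem8_general n hn d (fun _ => ATSP.sum_le_one_of_mem_closure_paramD hd) C hC
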